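/- For a number $y$ and $k\ge 0$ let $(y)_0=1$, $(y)_k=y(y+1)\cdots(y+k-1)$, and write $\left[\begin{smallmatrix}a,\dots,b\\ c,\dots,d\end{smallmatrix}\right]_k=\frac{(a)_k\cdots(b)_k}{(c)_k\cdots(d)_k}$; let $H_0=0$ and $H_k=\sum_{j=1}^k\frac1j$. Let $m,n,v$ be nonnegative integers with $v\le 2m+2$, let $P_1,\dots,P_{2m+2}$ be nonnegative integers, and put $T_s=1+P_s$ for $1\le s\le v$ and $T_s=-n-P_s$ for $v+1\le s\le 2m+2$. Let $$L=\sum_{k=0}^n\binom nk^2\prod_{s=1}^{v}\frac{\binom{k+P_s}{k}}{\binom{n+P_s}{k}}\prod_{s=v+1}^{2m+2}\frac{\binom{n+P_s}{k}}{\binom{k+P_s}{k}}\Big\{1+(n-2k)\Big(2H_k-\sum_{s=1}^{v}H_{k+P_s}+\sum_{s=v+1}^{2m+2}H_{k+P_s}\Big)\Big\}$$ and, for a real number $x$ and with $i_{m+1}=n$, $$R(x)=\left[\begin{matrix}-x-n,\ 1-x-n-T_{2m+1}-T_{2m+2}\\ 1-x-n-T_{2m+1},\ 1-x-n-T_{2m+2}\end{matrix}\right]_n\sum_{0\le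 i_1\le\cdots\le i_m\le n}\ \prod_{r=1}^m\left[\begin{matrix}-i_{r+1},\ T_{2r+1},\ T_{2r+2},\ 1-x-n-T_{2r-1}-T_{2r}\\ 1,\ T_{2r+1}+T_{2r+2}+x+n-i_{r+1},\ 1-x-n-T_{2r-1},\ 1-x-n-T_{2r}\end{matrix}\right]_{i_r}$$ (for $m=0$ the sum is $1$). Then $L=R(0)$, that is, $$L=\left[\begin{matrix}-n,\ 1-n-T_{2m+1}-T_{2m+2}\\ 1-n-T_{2m+1},\ 1-n-T_{2m+2}\end{matrix}\right]_n\sum_{0\le i_1\le\cdots\le i_m\le n}\ \prod_{r=1}^m\left[\begin{matrix}-i_{r+1},\ T_{2r+1},\ T_{2r+2},\ 1-n-T_{2r-1}-T_{2r}\\ 1,\ T_{2r+1}+T_{2r+2}+n-i_{r+1},\ 1-n-T_{2r-1},\ 1-n-T_{2r}\end{matrix}\right]_{i_r},$$ unless $v$ is odd, $v\ge3$ and $0\le P_v-P_{v+1}<n$ (exactly in this exceptional case some denominators on the right vanish). In all cases, including the exceptional one, $L=\lim_{x\to0,\,x\ne0}R(x)$. -/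

import Mathlib

open Filter Topology

/-- The shifted factorial `(x)_k = x (x + 1) ⋯ (x + k - 1)` of a real number. -/
noncomputable def poch (x : ℝ) (k : ℕ) : ℝ := (ascPochhammer ℝ k).eval x

/-- The parameters `T_s`, `1 ≤ s ≤ 2m+2` (the index `s` starts at `1`):
`T_s = 1 + P_s` for `s ≤ v` and `T_s = -n - P_s` for `s > v`. -/
def paramT (n v : ℕ) (P : ℕ → ℕ) (s : ℕ) : ℝ :=
  if s ≤ v then 1 + (P s : ℝ) else -(n : ℝ) - (P s : ℝ)

/-- The index tuples `0 ≤ i_1 ≤ i_2 ≤ ⋯ ≤ i_m ≤ i_{m+1} = n`; the entry `i_{r+1}` is the value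
of the tuple at position `r` of `Fin (m + 1)`. -/
def chains (m n : ℕ) : Finset (Fin (m + 1) → Fin (n + 1)) :=
  Finset.univ.filter fun i => (∀ a b, a ≤ b → i a ≤ i b) ∧ i (Fin.last m) = Fin.last n

/-- The factor with index `r` of the summand, where `j` is `i_r`, `l` is `i_{r+1}`, and
`t₁, t₂, t₃, t₄` are `T_{2r-1}, T_{2r}, T_{2r+1}, T_{2r+2}`. -/
noncomputable def nestedFactor (n : ℕ) (x t₁ t₂ t₃ t₄ : ℝ) (j l : ℕ) : ℝ :=
  (poch (-(l : ℝ)) j * poch t₃ j * poch t₄ j * poch (1 - x - n - t₁ - t₂) j) /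
    (poch 1 j * poch (t₃ + t₄ + x + n - l) j * poch (1 - x - n - t₁) j * poch (1 - x - n - t₂) j)

/-- The right-hand side, depending on an auxiliary real number `x`; the identity concerns `x = 0`.
The summation index `r : Fin m` stands for the index `r + 1` when counting from `1`. -/
noncomputable def nestedSum (m n : ℕ) (T : ℕ → ℝ) (x : ℝ) : ℝ :=
  (poch (-x - n) n * poch (1 - x - n - T (2 * m + 1) - T (2 * m + 2)) n) /
      (poch (1 - x - n - T (2 * m + 1)) n * poch (1 - x - n - T (2 * m + 2)) n) *
    ∑ i ∈ chains m n, ∏ r : Fin m,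
      nestedFactor n x (T (2 * (r : ℕ) + 1)) (T (2 * (r : ℕ) + 2))
        (T (2 * (r : ℕ) + 3)) (T (2 * (r : ℕ) + 4)) (i r.castSucc) (i r.succ)

/-- The left-hand side: the sum over `0 ≤ k ≤ n` with binomial coefficients and harmonic numbers. -/
noncomputable def harmonicSum (m n v : ℕ) (P : ℕ → ℕ) : ℝ :=
  ∑ k ∈ Finset.range (n + 1), (n.choose k : ℝ) ^ 2 *
    (∏ s ∈ Finset.Icc 1 v, ((k + P s).choose k : ℝ) / ((n + P s).choose k : ℝ)) *
    (∏ s ∈ Finset.Icc (v + 1) (2 * m + 2),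
      ((n + P s).choose k : ℝ) / ((k + P s).choose k : ℝ)) *
    (1 + ((n : ℝ) - 2 * k) *
      (2 * (harmonic k : ℝ) - ∑ s ∈ Finset.Icc 1 v, (harmonic (k + P s) : ℝ)
        + ∑ s ∈ Finset.Icc (v + 1) (2 * m + 2), (harmonic (k + P s) : ℝ)))

/-! Set `a = -x - n` and apply Bailey's lemma `m + 1` times to the unit Bailey pair relative to `a`,
with parameters `T (2r+1)`, `T (2r+2)`. On the `β` side the first step collapses and the others give
the nested sum (`chainBeta_eq_iteratedSum`); on the `α` side each parameter contributes one
well-poised quotient (`isBaileyPair_chain`). For non-integral `x` this yields `R(x) = f(x) / x`,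
where `f` is a very-well-poised sum with terms `(n - 2k + x) W_k(x)` (`nestedSum_eq_wellPoised`).

At `x = 0` the terms are antisymmetric under `k ↦ n - k`, so `f(0) = 0` and `R` tends to `f'(0)`.
Logarithmic differentiation of `W_k` produces harmonic numbers, and the same reflection turns those
at `n - k` into those at `k`, which gives `L` (`harmonicSum_eq`). Outside the exceptional case `R`
is continuous at `0`, so the limit is `R(0)`. -/

/-! ### Shifted factorials. -/

@[simp] lemma poch_zero (x : ℝ) : poch x 0 = 1 := by simp [poch]

lemma poch_succ (x : ℝ) (k : ℕ) : poch x (k + 1) = poch x k * (x + k) := by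
  simp [poch, ascPochhammer_succ_right]

lemma poch_succ_left (x : ℝ) (k : ℕ) : poch x (k + 1) = x * poch (x + 1) k := by
  simp [poch, ascPochhammer_succ_left]

lemma poch_add (x : ℝ) (k l : ℕ) : poch x (k + l) = poch x k * poch (x + k) l := by
  induction l with
  | zero => simp
  | succ l ih => rw [← add_assoc, poch_succ, poch_succ, ih]; push_cast; ring

lemma poch_ne_zero {x : ℝ} {k : ℕ} (h : ∀ j < k, x + (j : ℝ) ≠ 0) : poch x k ≠ 0 := by
  induction k with
  | zero => simp
  | succ k ih =>
    rw [poch_succ]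
    exact mul_ne_zero (ih fun j hj => h j (by omega)) (h k (by omega))

lemma poch_one (k : ℕ) : poch 1 k = k.factorial := by
  induction k with
  | zero => simp
  | succ k ih => rw [poch_succ, ih, Nat.factorial_succ]; push_cast; ring

lemma poch_neg (z : ℝ) (k : ℕ) : poch (-z) k = (-1) ^ k * poch (z - k + 1) k := by
  induction k with
  | zero => simp
  | succ k ih =>
    rw [poch_succ, ih, poch_succ_left]
    have : z - ((k + 1 : ℕ) : ℝ) + 1 + 1 = z - k + 1 := by push_cast; ring
    rw [this]; push_cast; ring

/-! ### Saalschütz summation and Bailey's lemma. -/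

/-- The Pfaff–Saalschütz summation in polynomial form. -/
lemma saalschutz (A B C : ℝ) (N : ℕ) :
    ∑ i ∈ Finset.range (N + 1), (N.choose i : ℝ) *
      (poch B i * poch C i * poch (A - B - C) (N - i) * poch (A + i) (N - i)) =
    poch (A - B) N * poch (A - C) N := by
  induction N with
  | zero => simp
  | succ N ih =>
    set t : ℕ → ℝ := fun i => poch B i * poch C i * poch (A - B - C) (N + 1 - i) *
      poch (A + i) (N + 1 - i) with ht
    set s : ℕ → ℝ := fun i => poch B i * poch C i * poch (A - B - C) (N - i) *
      poch (A + i) (N - i) with hs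
    -- Telescoping certificate for the recurrence in `N`, after Pascal's rule splits the binomial of
    -- `N + 1`. It vanishes at both ends: at `0` by the factor `i`, at `N + 1` by the binomial.
    set G : ℕ → ℝ := fun i => (i : ℝ) * (N.choose i : ℝ) *
      (poch B i * poch C i * poch (A - B - C) (N + 1 - i) * poch (A + i) (N - i)) with hG
    have key : ∀ i ∈ Finset.range (N + 1),
        (N.choose i : ℝ) * t i + (N.choose i : ℝ) * t (i + 1)
          - (A - B + N) * (A - C + N) * ((N.choose i : ℝ) * s i) = G (i + 1) - G i := by
      intro i hi
      obtain ⟨d, rfl⟩ := Nat.exists_eq_add_of_le (Nat.lt_succ_iff.mp (Finset.mem_range.mp hi))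
      have hch : ((i + 1 : ℕ) : ℝ) * ((i + d).choose (i + 1) : ℝ) = (i + d).choose i * d := by
        have := Nat.choose_succ_right_eq (i + d) i
        rw [Nat.add_sub_cancel_left] at this
        rw [mul_comm]; exact_mod_cast this
      simp only [ht, hs, hG, hch]
      have e1 : i + d + 1 - i = d + 1 := by omega
      have e2 : i + d + 1 - (i + 1) = d := by omega
      have e3 : i + d - i = d := by omega
      rw [e1, e2, e3]
      rcases d with _ | d
      · simp [poch_succ]; ring
      · have e4 : i + (d + 1) - (i + 1) = d := by omega
        rw [e4]
        have h1 : poch (A + i) (d + 1) = (A + i) * poch (A + i + 1) d := poch_succ_left _ _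
        have h2 : poch (A + i) (d + 1 + 1) = (A + i) * (poch (A + i + 1) d * (A + i + 1 + d)) := by
          rw [poch_succ_left, poch_succ]
        have h3 : poch (A + ((i + 1 : ℕ) : ℝ)) (d + 1) =
            poch (A + i + 1) d * (A + i + 1 + d) := by
          rw [← poch_succ]; push_cast; ring_nf
        have h4 : poch (A + ((i + 1 : ℕ) : ℝ)) d = poch (A + i + 1) d := by
          push_cast; ring_nf
        rw [h1, h2, h3, h4, poch_succ (A - B - C) (d + 1), poch_succ B, poch_succ C]
        push_cast
        ring
    have tel := Finset.sum_congr rfl key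
    rw [Finset.sum_range_sub, Finset.sum_sub_distrib, Finset.sum_add_distrib,
      ← Finset.mul_sum] at tel
    have hG0 : G 0 = 0 := by simp [hG]
    have hGN : G (N + 1) = 0 := by simp [hG]
    have hpas : ∑ i ∈ Finset.range (N + 1 + 1), ((N + 1).choose i : ℝ) * t i =
        ∑ i ∈ Finset.range (N + 1), (N.choose i : ℝ) * t i +
          ∑ i ∈ Finset.range (N + 1), (N.choose i : ℝ) * t (i + 1) := by
      rw [Finset.sum_range_succ' (n := N + 1)]
      simp only [Nat.choose_succ_succ, Nat.cast_add, add_mul, Finset.sum_add_distrib]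
      have := Finset.sum_range_succ' (fun i => (N.choose i : ℝ) * t i) (N + 1)
      rw [Finset.sum_range_succ] at this
      simp only [Nat.choose_succ_self, Nat.cast_zero, zero_mul, add_zero] at this
      rw [this]; simp; ring
    change ∑ i ∈ Finset.range (N + 1 + 1), ((N + 1).choose i : ℝ) * t i = _
    rw [hpas, poch_succ, poch_succ]
    rw [hG0, hGN, ih] at tel
    linear_combination tel

lemma saalschutz_div (A B C : ℝ) (N : ℕ) (hA : ∀ k : ℕ, A + (k : ℝ) ≠ 0) :
    ∑ i ∈ Finset.range (N + 1), poch B i * poch C i * poch (A - B - C) (N - i) /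
      ((N - i).factorial * (i.factorial * poch A i)) =
    poch (A - B) N * poch (A - C) N / (N.factorial * poch A N) := by
  have hp : ∀ k, poch A k ≠ 0 := fun k => poch_ne_zero fun j _ => hA j
  rw [eq_div_iff (mul_ne_zero (by positivity) (hp N)), ← saalschutz, Finset.sum_mul]
  refine Finset.sum_congr rfl fun i hi => ?_
  have hi' : i ≤ N := Nat.lt_succ_iff.mp (Finset.mem_range.mp hi)
  have h1 : poch A N = poch A i * poch (A + i) (N - i) := by
    rw [← poch_add, Nat.add_sub_cancel' hi']
  rw [h1, Nat.cast_choose ℝ hi']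
  have := hp i
  have : ((N - i).factorial : ℝ) ≠ 0 := by positivity
  have : (i.factorial : ℝ) ≠ 0 := by positivity
  field_simp

/-- Bailey pairs relative to `a`, in the limit `q → 1`. -/
def IsBaileyPair (a : ℝ) (α β : ℕ → ℝ) : Prop :=
  ∀ L, β L = ∑ r ∈ Finset.range (L + 1), α r / ((L - r).factorial * poch (a + 1) (L + r))

/-- One step of the Bailey chain on the `β` side. -/
noncomputable def baileyStep (a b c : ℝ) (β : ℕ → ℝ) (L : ℕ) : ℝ :=
  ∑ j ∈ Finset.range (L + 1), poch b j * poch c j * poch (1 + a - b - c) (L - j) /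
    ((L - j).factorial * (poch (1 + a - b) L * poch (1 + a - c) L)) * β j

/-- Bailey's lemma: after exchanging the two sums and writing `j = r + i`, the inner sum is
Saalschütz's with `A = a + 1 + 2r`, `B = b + r`, `C = c + r`. -/
lemma IsBaileyPair.step {a b c : ℝ} {α β : ℕ → ℝ} (h : IsBaileyPair a α β)
    (ha : ∀ k : ℕ, a + 1 + (k : ℝ) ≠ 0)
    (hb : ∀ k, poch (1 + a - b) k ≠ 0) (hc : ∀ k, poch (1 + a - c) k ≠ 0) :
    IsBaileyPair a
      (fun r => α r * (poch b r * poch c r / (poch (1 + a - b) r * poch (1 + a - c) r)))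
      (baileyStep a b c β) := by
  intro L
  unfold baileyStep
  have h' : ∀ j, β j = ∑ r ∈ Finset.range (j + 1),
      α r / ((j - r).factorial * poch (a + 1) (j + r)) := h
  simp only [h', Finset.mul_sum]
  rw [Finset.sum_comm' (t' := Finset.range (L + 1)) (s' := fun r => Finset.Ico r (L + 1))
    (by intro x y; simp only [Finset.mem_range, Finset.mem_Ico]; omega)]
  refine Finset.sum_congr rfl fun r hr => ?_
  obtain ⟨N, rfl⟩ := Nat.exists_eq_add_of_le (Nat.lt_succ_iff.mp (Finset.mem_range.mp hr))
  rw [Finset.sum_Ico_eq_sum_range]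
  have e0 : r + N + 1 - r = N + 1 := by omega
  have e1 : r + N - r = N := by omega
  rw [e0, e1]
  have hA : ∀ k : ℕ, a + 1 + ((r + r : ℕ) : ℝ) + (k : ℝ) ≠ 0 := fun k => by
    have := ha (r + r + k); push_cast at this ⊢; rwa [add_assoc (a + 1)]
  have hpa : ∀ k, poch (a + 1) k ≠ 0 := fun k => poch_ne_zero fun j _ => ha j
  have hpA : ∀ k, poch (a + 1 + ((r + r : ℕ) : ℝ)) k ≠ 0 := fun k => poch_ne_zero fun j _ => hA j
  have S := saalschutz_div (a + 1 + ((r + r : ℕ) : ℝ)) (b + r) (c + r) N hA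
  have f1 : a + 1 + ((r + r : ℕ) : ℝ) - (b + r) - (c + r) = 1 + a - b - c := by push_cast; ring
  have f2 : a + 1 + ((r + r : ℕ) : ℝ) - (b + r) = 1 + a - b + r := by push_cast; ring
  have f3 : a + 1 + ((r + r : ℕ) : ℝ) - (c + r) = 1 + a - c + r := by push_cast; ring
  rw [f1, f2, f3] at S
  have g1 : r + N + r = r + r + N := by omega
  calc _ = ∑ i ∈ Finset.range (N + 1), (α r * (poch b r * poch c r) /
        (poch (a + 1) (r + r) * (poch (1 + a - b) (r + N) * poch (1 + a - c) (r + N)))) *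
        (poch (b + r) i * poch (c + r) i * poch (1 + a - b - c) (N - i) /
        ((N - i).factorial * (i.factorial * poch (a + 1 + ((r + r : ℕ) : ℝ)) i))) := by
        refine Finset.sum_congr rfl fun i hi => ?_
        have g2 : r + N - (r + i) = N - i := by omega
        have g3 : r + i - r = i := by omega
        have g4 : r + i + r = r + r + i := by omega
        rw [g2, g3, g4, poch_add b, poch_add c, poch_add (a + 1) (r + r) i]
        have := hpa (r + r)
        have := hpA i
        have := hb (r + N)
        have := hc (r + N)
        field_simp
    _ = _ := by
        rw [← Finset.mul_sum, S, g1, poch_add (a + 1) (r + r) N, poch_add (1 + a - b) r N,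
          poch_add (1 + a - c) r N]
        have := hpa (r + r)
        have := hpA N
        have h1 := hb (r + N)
        have h2 := hc (r + N)
        rw [poch_add, mul_ne_zero_iff] at h1 h2
        obtain ⟨h1, h1'⟩ := h1
        obtain ⟨h2, h2'⟩ := h2
        field_simp

/-! ### The unit Bailey pair and its chain. -/

/-- The `α` part of the unit Bailey pair. -/
noncomputable def unitAlpha (a : ℝ) (r : ℕ) : ℝ :=
  (-1) ^ r * ((a + 2 * r) / a) * (poch a r / r.factorial)

/-- Truncated sums have a closed form, which makes induction on `R` possible. At `R = L` only the
term `r = L + 1` of the full sum is missing, and it cancels the closed form. -/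
lemma unitAlpha_partial_sum {a : ℝ} (ha0 : a ≠ 0) (ha : ∀ k : ℕ, a + 1 + (k : ℝ) ≠ 0)
    (L R : ℕ) (hR : R ≤ L) :
    ∑ r ∈ Finset.range (R + 1), unitAlpha a r / ((L + 1 - r).factorial * poch (a + 1) (L + 1 + r)) =
      (-1) ^ R * poch (a + 1) R /
        ((L + 1) * R.factorial * (L - R).factorial * poch (a + 1) (L + 1 + R)) := by
  have hpa : ∀ k, poch (a + 1) k ≠ 0 := fun k => poch_ne_zero fun j _ => ha j
  induction R with
  | zero =>
    have := hpa (L + 1)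
    simp [unitAlpha, ha0, Nat.factorial_succ]
  | succ R ih =>
    rw [Finset.sum_range_succ, ih (by omega)]
    obtain ⟨d, rfl⟩ := Nat.exists_eq_add_of_le hR
    have e1 : R + 1 + d + 1 - (R + 1) = d + 1 := by omega
    have e2 : R + 1 + d - R = d + 1 := by omega
    have e3 : R + 1 + d - (R + 1) = d := by omega
    rw [e1, e2, e3, unitAlpha, poch_succ_left a, poch_succ (a + 1) R, Nat.factorial_succ d,
      Nat.factorial_succ R, ← add_assoc (R + 1 + d + 1), poch_succ (a + 1) (R + 1 + d + 1 + R)]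
    have h1 := hpa (R + 1 + d + 1 + R)
    have h2 := ha (R + 1 + d + 1 + R)
    have h3 : (R : ℝ) + 1 + d + 1 ≠ 0 := by positivity
    push_cast at h2 ⊢
    field_simp
    ring

lemma isBaileyPair_unit {a : ℝ} (ha0 : a ≠ 0) (ha : ∀ k : ℕ, a + 1 + (k : ℝ) ≠ 0) :
    IsBaileyPair a (unitAlpha a) (fun L => if L = 0 then 1 else 0) := by
  rintro (_ | L)
  · simp [unitAlpha, ha0]
  · have hpa : ∀ k, poch (a + 1) k ≠ 0 := fun k => poch_ne_zero fun j _ => ha j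
    rw [Finset.sum_range_succ, unitAlpha_partial_sum ha0 ha L L le_rfl]
    rw [unitAlpha, poch_succ_left a L, Nat.factorial_succ, ← add_assoc (L + 1),
      poch_succ (a + 1) (L + 1 + L)]
    have h1 := hpa (L + 1 + L)
    have h2 := ha (L + 1 + L)
    have h3 : (L : ℝ) + 1 ≠ 0 := by positivity
    push_cast at h2 ⊢
    simp only [Nat.sub_self, Nat.factorial_zero, Nat.cast_one]
    field_simp
    ring

/-- The `β` parts of the Bailey chain that starts from the unit pair. -/
noncomputable def chainBeta (a : ℝ) (T : ℕ → ℝ) : ℕ → ℕ → ℝ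
  | 0 => fun L => if L = 0 then 1 else 0
  | m + 1 => baileyStep a (T (2 * m + 1)) (T (2 * m + 2)) (chainBeta a T m)

lemma isBaileyPair_chain {a : ℝ} {T : ℕ → ℝ} (ha0 : a ≠ 0) (ha : ∀ k : ℕ, a + 1 + (k : ℝ) ≠ 0)
    (hT : ∀ s k, poch (1 + a - T s) k ≠ 0) (m : ℕ) :
    IsBaileyPair a
      (fun r => unitAlpha a r * ∏ s ∈ Finset.Icc 1 (2 * m), poch (T s) r / poch (1 + a - T s) r)
      (chainBeta a T m) := by
  induction m with
  | zero => simpa [chainBeta] using isBaileyPair_unit ha0 ha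
  | succ m ih =>
    have := ih.step ha (hT (2 * m + 1)) (hT (2 * m + 2))
    rw [chainBeta]
    convert this using 2 with r
    rw [show 2 * (m + 1) = 2 * m + 1 + 1 by ring, Finset.prod_Icc_succ_top (by omega),
      Finset.prod_Icc_succ_top (by omega), mul_div_mul_comm]
    ring

/-! ### The nested sum as the `β` side. -/

/-- Monotone tuples with values in `Fin (n + 1)` and prescribed last entry. -/
def chainsTo (m n : ℕ) (l : Fin (n + 1)) : Finset (Fin (m + 1) → Fin (n + 1)) :=
  Finset.univ.filter fun i => (∀ a b, a ≤ b → i a ≤ i b) ∧ i (Fin.last m) = l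

/-- Deleting the fixed last entry leaves a shorter chain whose end `j` may be anything up to `l`;
this is the recursion of `iteratedSum`. -/
lemma sum_chainsTo_succ (m n : ℕ) (l : Fin (n + 1)) (g : (Fin (m + 2) → Fin (n + 1)) → ℝ) :
    ∑ i ∈ chainsTo (m + 1) n l, g i =
      ∑ j ∈ Finset.Iic l, ∑ i ∈ chainsTo m n j, g (Fin.snoc (α := fun _ => Fin (n + 1)) i l) := by
  rw [Finset.sum_sigma']
  refine Finset.sum_bij'
    (fun i _ => (⟨i (Fin.last m).castSucc, fun r => i r.castSucc⟩ :
      Σ _ : Fin (n + 1), (Fin (m + 1) → Fin (n + 1))))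
    (fun p _ => Fin.snoc (α := fun _ => Fin (n + 1)) p.2 l) ?_ ?_ ?_ ?_ ?_
  · intro i hi
    simp only [chainsTo, Finset.mem_filter, Finset.mem_univ, true_and, Finset.mem_sigma,
      Finset.mem_Iic] at hi ⊢
    refine ⟨hi.2 ▸ hi.1 _ _ (Fin.le_last _), fun a b hab => hi.1 _ _ ?_, trivial⟩
    simpa using hab
  · rintro ⟨j, i⟩ hi
    simp only [chainsTo, Finset.mem_filter, Finset.mem_univ, true_and, Finset.mem_sigma,
      Finset.mem_Iic] at hi ⊢
    obtain ⟨hj, hmono, hlast⟩ := hi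
    refine ⟨fun a b hab => ?_, by simp⟩
    induction b using Fin.lastCases with
    | last =>
      induction a using Fin.lastCases with
      | last => simp
      | cast a =>
        rw [Fin.snoc_last, Fin.snoc_castSucc]
        exact ((hmono a _ (Fin.le_last a)).trans hlast.le).trans hj
    | cast b =>
      induction a using Fin.lastCases with
      | last => exact absurd hab (not_le.mpr (Fin.castSucc_lt_last b))
      | cast a =>
        rw [Fin.snoc_castSucc, Fin.snoc_castSucc]
        exact hmono a b (by simpa using hab)
  · intro i hi
    simp only [chainsTo, Finset.mem_filter, Finset.mem_univ, true_and] at hi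
    rw [← hi.2]
    exact Fin.snoc_init_self (α := fun _ => Fin (n + 1)) i
  · rintro ⟨j, i⟩ hi
    simp only [chainsTo, Finset.mem_filter, Finset.mem_univ, true_and, Finset.mem_sigma,
      Finset.mem_Iic] at hi
    obtain ⟨hj, hmono, rfl⟩ := hi
    simp
  · intro i hi
    simp only [chainsTo, Finset.mem_filter, Finset.mem_univ, true_and] at hi
    congr 1
    rw [← hi.2]
    exact (Fin.snoc_init_self (α := fun _ => Fin (n + 1)) i).symm

/-- Iterated sums along chains `j ≤ ⋯ ≤ l` with weights `w`. -/
noncomputable def iteratedSum (w : ℕ → ℕ → ℕ → ℝ) : ℕ → ℕ → ℝ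
  | 0, _ => 1
  | m + 1, l => ∑ j ∈ Finset.range (l + 1), w m j l * iteratedSum w m j

lemma sum_chainsTo_prod (w : ℕ → ℕ → ℕ → ℝ) (m n : ℕ) (l : Fin (n + 1)) :
    ∑ i ∈ chainsTo m n l, ∏ r : Fin m, w r (i r.castSucc) (i r.succ) = iteratedSum w m l := by
  induction m generalizing l with
  | zero =>
    have : chainsTo 0 n l = {fun _ => l} := by
      ext i
      simp only [chainsTo, Finset.mem_filter, Finset.mem_univ, true_and, Finset.mem_singleton]
      constructor
      · rintro ⟨-, h⟩
        funext r
        rw [← h, show r = Fin.last 0 from Fin.ext (by have := r.2; simp)]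
      · rintro rfl
        exact ⟨fun _ _ _ => le_rfl, rfl⟩
    simp [this, iteratedSum]
  | succ m ih =>
    rw [sum_chainsTo_succ, iteratedSum]
    have hin : ∀ j : Fin (n + 1), ∑ i ∈ chainsTo m n j, ∏ r : Fin (m + 1),
        w r (Fin.snoc (α := fun _ => Fin (n + 1)) i l r.castSucc : Fin (n + 1))
          (Fin.snoc (α := fun _ => Fin (n + 1)) i l r.succ : Fin (n + 1)) =
        w m j l * iteratedSum w m j := by
      intro j
      rw [← ih, Finset.mul_sum]
      refine Finset.sum_congr rfl fun i hi => ?_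
      simp only [chainsTo, Finset.mem_filter, Finset.mem_univ, true_and] at hi
      rw [Fin.prod_univ_castSucc, mul_comm]
      simp only [Fin.succ_last, Fin.snoc_last, Fin.snoc_castSucc, ← Fin.castSucc_succ,
        Fin.val_last, Fin.val_castSucc, hi.2]
    simp only [hin]
    refine Finset.sum_bij (fun j _ => (j : ℕ)) ?_ ?_ ?_ ?_
    · intro j hj
      rw [Finset.mem_Iic, Fin.le_def] at hj
      exact Finset.mem_range.mpr (by omega)
    · intro a _ b _ h
      exact Fin.ext h
    · intro b hb
      rw [Finset.mem_range] at hb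
      exact ⟨⟨b, by omega⟩, by rw [Finset.mem_Iic, Fin.le_def]; simp; omega, rfl⟩
    · intro j _
      rfl

lemma nestedSum_eq_iteratedSum (m n : ℕ) (T : ℕ → ℝ) (x : ℝ) :
    nestedSum m n T x =
      (poch (-x - n) n * poch (1 - x - n - T (2 * m + 1) - T (2 * m + 2)) n) /
        (poch (1 - x - n - T (2 * m + 1)) n * poch (1 - x - n - T (2 * m + 2)) n) *
      iteratedSum (fun r => nestedFactor n x (T (2 * r + 1)) (T (2 * r + 2))
        (T (2 * r + 3)) (T (2 * r + 4))) m n := by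
  have := sum_chainsTo_prod (fun r => nestedFactor n x (T (2 * r + 1)) (T (2 * r + 2))
        (T (2 * r + 3)) (T (2 * r + 4))) m n (Fin.last n)
  rw [Fin.val_last] at this
  rw [← this]
  rfl

lemma poch_neg_natCast (L j : ℕ) (h : j ≤ L) :
    poch (-(L : ℝ)) j = (-1) ^ j * (L.factorial / (L - j).factorial) := by
  induction j with
  | zero => simp [div_self (Nat.cast_ne_zero.mpr L.factorial_ne_zero : (L.factorial : ℝ) ≠ 0)]
  | succ j ih =>
    obtain ⟨d, rfl⟩ := Nat.exists_eq_add_of_le h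
    have e1 : j + 1 + d - j = d + 1 := by omega
    have e2 : j + 1 + d - (j + 1) = d := by omega
    rw [poch_succ, ih (by omega), e1, e2, Nat.factorial_succ d]
    push_cast
    field_simp
    ring

/-- Reversing the factorials of length `L - j` moves them to length `j`, as in `nestedFactor`; the
two signs `(-1) ^ j` cancel. -/
lemma baileyStep_eq {a b c : ℝ} {β : ℕ → ℝ} (L : ℕ) (h : poch (1 + a - b - c) L ≠ 0) :
    baileyStep a b c β L = poch (1 + a - b - c) L /
      (L.factorial * (poch (1 + a - b) L * poch (1 + a - c) L)) *
      ∑ j ∈ Finset.range (L + 1),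
        poch (-(L : ℝ)) j * poch b j * poch c j / poch (b + c - a - L) j * β j := by
  rw [baileyStep, Finset.mul_sum]
  refine Finset.sum_congr rfl fun j hj => ?_
  have hj' : j ≤ L := Nat.lt_succ_iff.mp (Finset.mem_range.mp hj)
  obtain ⟨d, rfl⟩ := Nat.exists_eq_add_of_le hj'
  have e1 : j + d - j = d := by omega
  have h1 : poch (1 + a - b - c) (j + d) =
      poch (1 + a - b - c) d * ((-1) ^ j * poch (b + c - a - ((j + d : ℕ) : ℝ)) j) := by
    rw [add_comm j d, poch_add, show 1 + a - b - c + (d : ℝ) = -(b + c - a - 1 - d) by ring,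
      poch_neg]
    congr 3
    push_cast; ring
  rw [h1] at h ⊢
  rw [poch_neg_natCast _ _ hj', e1]
  have hp : poch (b + c - a - ((j + d : ℕ) : ℝ)) j ≠ 0 := by
    intro h0; rw [h0] at h; simp at h
  have hs : ((-1 : ℝ) ^ j) * (-1) ^ j = 1 := by rw [← mul_pow]; simp
  generalize (poch (1 + a - b) (j + d) * poch (1 + a - c) (j + d)) = D
  have : ((j + d).factorial : ℝ) ≠ 0 := by positivity
  have : (d.factorial : ℝ) ≠ 0 := by positivity
  calc _ = poch b j * poch c j * poch (1 + a - b - c) d / (d.factorial * D) * β j *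
        ((-1 : ℝ) ^ j * (-1) ^ j) := by rw [hs, mul_one]
    _ = _ := by
      -- `D` may vanish; then both sides are `0` by the convention for division by zero.
      rcases eq_or_ne D 0 with rfl | hD
      · simp
      · field_simp

/-- The step applied to the unit pair keeps only `j = 0`, so `m + 1` steps leave `m` summations. The
prefactor of each step supplies the remaining part of the next `nestedFactor`. -/
lemma chainBeta_eq_iteratedSum {n : ℕ} {x : ℝ} {T : ℕ → ℝ}
    (h : ∀ r k, poch (1 - x - n - T (2 * r + 1) - T (2 * r + 2)) k ≠ 0) (m L : ℕ) :
    chainBeta (-x - n) T (m + 1) L = poch (1 - x - n - T (2 * m + 1) - T (2 * m + 2)) L /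
      (L.factorial * (poch (1 - x - n - T (2 * m + 1)) L * poch (1 - x - n - T (2 * m + 2)) L)) *
      iteratedSum (fun r => nestedFactor n x (T (2 * r + 1)) (T (2 * r + 2))
        (T (2 * r + 3)) (T (2 * r + 4))) m L := by
  have e : ∀ y : ℝ, 1 + (-x - n) - y = 1 - x - n - y := fun y => by ring
  induction m generalizing L with
  | zero =>
    rw [chainBeta, baileyStep_eq _ (by rw [e]; exact h 0 L), Finset.sum_range_succ']
    simp [chainBeta, iteratedSum, e]
  | succ m ih =>
    rw [chainBeta, baileyStep_eq _ (by rw [e]; exact h (m + 1) L), iteratedSum]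
    simp only [e, ih]
    congr 1
    refine Finset.sum_congr rfl fun j _ => ?_
    rw [nestedFactor, poch_one, show 2 * (m + 1) + 1 = 2 * m + 3 by ring,
      show 2 * (m + 1) + 2 = 2 * m + 4 by ring,
      show T (2 * m + 3) + T (2 * m + 4) - (-x - n) - (L : ℝ) =
        T (2 * m + 3) + T (2 * m + 4) + x + n - L by ring]
    simp only [div_eq_mul_inv, mul_inv]
    ring

/-! ### The very-well-poised sum as the `α` side. -/

/-- The well-poised term without its very-well-poised factor. -/
noncomputable def wellPoised (M n : ℕ) (T : ℕ → ℝ) (k : ℕ) (x : ℝ) : ℝ :=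
  poch (-n - x) k * poch (-n) k * ((k.factorial : ℝ) * poch (1 - x) k)⁻¹ *
    ∏ s ∈ Finset.Icc 1 M, poch (T s) k * (poch (1 - n - T s - x) k)⁻¹

/-- This is the Bailey pair relation at `L = n`. Since all `T s` are integers, a non-integral `x`
keeps every denominator away from zero. -/
lemma nestedSum_eq_wellPoised {m n : ℕ} {T : ℕ → ℝ} {x : ℝ}
    (hx : ∀ z : ℤ, x ≠ z) (hT : ∀ s, ∃ z : ℤ, T s = z) :
    nestedSum m n T x =
      x⁻¹ * ∑ k ∈ Finset.range (n + 1), (n - 2 * k + x) * wellPoised (2 * (m + 1)) n T k x := by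
  choose t ht using hT
  have hx0 : x ≠ 0 := by simpa using hx 0
  have e : ∀ y : ℝ, 1 + (-x - n) - y = 1 - n - y - x := fun y => by ring
  have ha0 : -x - (n : ℝ) ≠ 0 := fun h => hx (-n) (by push_cast; linarith)
  have ha : ∀ k : ℕ, -x - (n : ℝ) + 1 + (k : ℝ) ≠ 0 :=
    fun k h => hx (-n + 1 + k) (by push_cast; linarith)
  have h1 : ∀ k, poch (1 - x) k ≠ 0 := fun k => poch_ne_zero fun j _ h =>
    hx (1 + j) (by push_cast; linarith)
  have hT1 : ∀ s k, poch (1 + (-x - n) - T s) k ≠ 0 := fun s k => poch_ne_zero fun j _ h =>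
    hx (1 - n - t s + j) (by rw [ht] at h; push_cast; linarith)
  have hT2 : ∀ r k, poch (1 - x - n - T (2 * r + 1) - T (2 * r + 2)) k ≠ 0 := fun r k =>
    poch_ne_zero fun j _ h =>
      hx (1 - n - t (2 * r + 1) - t (2 * r + 2) + j) (by simp only [ht] at h; push_cast; linarith)
  have hB := isBaileyPair_chain ha0 ha hT1 (m + 1) n
  rw [chainBeta_eq_iteratedSum hT2] at hB
  have hn : (n.factorial : ℝ) ≠ 0 := by positivity
  have : nestedSum m n T x = poch (-x - n) n * n.factorial *
      ∑ r ∈ Finset.range (n + 1), (unitAlpha (-x - n) r * ∏ s ∈ Finset.Icc 1 (2 * (m + 1)),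
        poch (T s) r / poch (1 + (-x - n) - T s) r) /
          ((n - r).factorial * poch (-x - n + 1) (n + r)) := by
    rw [nestedSum_eq_iteratedSum, ← hB]
    simp only [div_eq_mul_inv, mul_inv]
    field_simp
  rw [this, Finset.mul_sum, Finset.mul_sum]
  refine Finset.sum_congr rfl fun k hk => ?_
  have hk' : k ≤ n := Nat.lt_succ_iff.mp (Finset.mem_range.mp hk)
  rw [wellPoised, unitAlpha, poch_neg_natCast _ _ hk', poch_add,
    show -x - (n : ℝ) + 1 + n = 1 - x by ring]
  simp only [e, ← div_eq_mul_inv]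
  -- The factor `x⁻¹` arises here, from `a + n = -x`.
  have hsw : poch (-x - n) n * (-x) = (-x - n) * poch (-x - n + 1) n := by
    rw [← poch_succ_left, poch_succ]; ring
  have hpa : poch (-x - (n : ℝ) + 1) n ≠ 0 := poch_ne_zero fun j _ => ha j
  have hsw' : poch (-x - (n : ℝ)) n = (-x - n) * poch (-x - n + 1) n / (-x) := by
    rw [← hsw]; field_simp
  rw [hsw', show -(n : ℝ) - x = -x - n by ring]
  have hfk : (k.factorial : ℝ) ≠ 0 := by positivity
  have hfnk : ((n - k).factorial : ℝ) ≠ 0 := by positivity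
  have := h1 k
  generalize (∏ s ∈ Finset.Icc 1 (2 * (m + 1)), poch (T s) k / poch (1 - n - T s - x) k) = Q
  generalize poch (-x - (n : ℝ)) k = W
  field_simp
  ring

/-! ### Logarithmic derivatives, and values at `x = 0`. -/

/-- `f` has logarithmic derivative `d` at `x`, also when `f x = 0`. -/
def HasLogDerivAt (f : ℝ → ℝ) (d x : ℝ) : Prop := HasDerivAt f (f x * d) x

lemma HasLogDerivAt.mul {f g : ℝ → ℝ} {d e x : ℝ} (hf : HasLogDerivAt f d x)
    (hg : HasLogDerivAt g e x) : HasLogDerivAt (fun y => f y * g y) (d + e) x := by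
  unfold HasLogDerivAt at *
  exact (hf.fun_mul hg).congr_deriv (by ring)

lemma HasLogDerivAt.inv {f : ℝ → ℝ} {d x : ℝ} (hf : HasLogDerivAt f d x) (h0 : f x ≠ 0) :
    HasLogDerivAt (fun y => (f y)⁻¹) (-d) x := by
  unfold HasLogDerivAt at *
  exact (hf.fun_inv h0).congr_deriv (by field_simp)

lemma hasLogDerivAt_const (c x : ℝ) : HasLogDerivAt (fun _ => c) 0 x := by
  unfold HasLogDerivAt
  simpa using hasDerivAt_const x c

lemma HasLogDerivAt.prod {ι : Type*} (s : Finset ι) {f : ι → ℝ → ℝ} {d : ι → ℝ} {x : ℝ}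
    (h : ∀ i ∈ s, HasLogDerivAt (f i) (d i) x) :
    HasLogDerivAt (fun y => ∏ i ∈ s, f i y) (∑ i ∈ s, d i) x := by
  classical
  induction s using Finset.induction_on with
  | empty => simpa using hasLogDerivAt_const 1 x
  | insert a s ha ih =>
    simp only [Finset.prod_insert ha, Finset.sum_insert ha]
    exact (h a (by simp)).mul (ih fun i hi => h i (by simp [hi]))

lemma hasLogDerivAt_poch {c : ℝ} {k : ℕ} (h : ∀ j < k, c + (j : ℝ) ≠ 0) :
    HasLogDerivAt (fun x => poch (c - x) k) (-∑ j ∈ Finset.range k, (c + (j : ℝ))⁻¹) 0 := by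
  induction k with
  | zero => simpa using hasLogDerivAt_const 1 0
  | succ k ih =>
    have h1 : HasLogDerivAt (fun x => c - x + k) (-(c + (k : ℝ))⁻¹) 0 := by
      unfold HasLogDerivAt
      have := ((hasDerivAt_id (0 : ℝ)).const_sub c).add_const (k : ℝ)
      refine this.congr_deriv ?_
      have := h k (by omega)
      simp only [sub_zero]
      field_simp
    have := (ih fun j hj => h j (by omega)).mul h1
    simpa only [poch_succ, Finset.sum_range_succ, neg_add] using this

lemma sum_inv_add_natCast (P k : ℕ) :
    ∑ j ∈ Finset.range k, (1 + (P : ℝ) + j)⁻¹ = harmonic (k + P) - harmonic P := by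
  induction k with
  | zero => simp
  | succ k ih =>
    rw [Finset.sum_range_succ, ih, show k + 1 + P = k + P + 1 by ring, harmonic_succ]
    push_cast
    rw [show 1 + (P : ℝ) + k = k + P + 1 by ring]
    ring

lemma sum_inv_neg_add_natCast (N k : ℕ) (h : k ≤ N) :
    ∑ j ∈ Finset.range k, (-(N : ℝ) + j)⁻¹ = harmonic (N - k : ℕ) - harmonic N := by
  induction k with
  | zero => simp
  | succ k ih =>
    obtain ⟨d, rfl⟩ := Nat.exists_eq_add_of_le h
    rw [Finset.sum_range_succ, ih (by omega), show k + 1 + d - k = d + 1 by omega,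
      show k + 1 + d - (k + 1) = d by omega, harmonic_succ d]
    push_cast
    rw [show -((k : ℝ) + 1 + d) + k = -(d + 1) by ring, inv_neg]
    ring

lemma poch_one_add_natCast (P k : ℕ) : poch (1 + (P : ℝ)) k = k.factorial * (k + P).choose k := by
  have h : (P.factorial : ℝ) * poch (1 + (P : ℝ)) k = (k + P).factorial := by
    rw [← poch_one, ← poch_one, ← poch_add, add_comm]
  have hP : (P.factorial : ℝ) ≠ 0 := by positivity
  have := Nat.choose_mul_factorial_mul_factorial (Nat.le_add_right k P)
  rw [Nat.add_sub_cancel_left] at this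
  have : ((k + P).choose k : ℝ) * k.factorial * P.factorial = (k + P).factorial := by
    exact_mod_cast this
  apply mul_left_cancel₀ hP
  linear_combination h - this

lemma poch_neg_natCast_eq_choose (N k : ℕ) (h : k ≤ N) :
    poch (-(N : ℝ)) k = (-1) ^ k * (k.factorial * N.choose k) := by
  have hk : (k.factorial : ℝ) ≠ 0 := by positivity
  rw [poch_neg_natCast N k h, Nat.cast_choose ℝ h]
  field_simp

/-- The binomial ratio attached to the parameter `s`. -/
noncomputable def binomRatio (n v : ℕ) (P : ℕ → ℕ) (s k : ℕ) : ℝ :=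
  if s ≤ v then ((k + P s).choose k : ℝ) / (n + P s).choose k
  else ((n + P s).choose k : ℝ) / (k + P s).choose k

/-- The logarithmic derivative of the factor attached to the parameter `s`. -/
noncomputable def logDerivTerm (n v : ℕ) (P : ℕ → ℕ) (s k : ℕ) : ℝ :=
  if s ≤ v then (harmonic (n - k + P s) : ℝ) - harmonic (n + P s)
  else (harmonic (k + P s) : ℝ) - harmonic (P s)

/-- The involution `T ↦ 1 - n - T` exchanges the two kinds of parameters, `1 + P` and `-n - P`. -/
lemma one_sub_paramT (n v : ℕ) (P : ℕ → ℕ) (s : ℕ) :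
    1 - (n : ℝ) - paramT n v P s =
      if s ≤ v then -((n + P s : ℕ) : ℝ) else 1 + (P s : ℝ) := by
  unfold paramT
  split_ifs <;> push_cast <;> ring

lemma one_sub_paramT_add_ne_zero (n v : ℕ) (P : ℕ → ℕ) (s j : ℕ) (hj : j < n) :
    1 - (n : ℝ) - paramT n v P s + j ≠ 0 := by
  rw [one_sub_paramT]
  split_ifs
  · have : (j : ℝ) < n := by exact_mod_cast hj
    have : (0 : ℝ) ≤ P s := by positivity
    push_cast
    intro h; linarith
  · positivity

lemma poch_paramT_ratio (n v : ℕ) (P : ℕ → ℕ) (s k : ℕ) (hk : k ≤ n) :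
    poch (paramT n v P s) k * (poch (1 - n - paramT n v P s) k)⁻¹ =
      (-1) ^ k * binomRatio n v P s k := by
  have hkf : (k.factorial : ℝ) ≠ 0 := by positivity
  have h1 : (((n + P s).choose k : ℕ) : ℝ) ≠ 0 :=
    Nat.cast_ne_zero.mpr (Nat.choose_pos (by omega)).ne'
  have h2 : (((k + P s).choose k : ℕ) : ℝ) ≠ 0 :=
    Nat.cast_ne_zero.mpr (Nat.choose_pos (by omega)).ne'
  have hs : ((-1 : ℝ) ^ k) * (-1) ^ k = 1 := by rw [← mul_pow]; simp
  have hs' : ((-1 : ℝ) ^ k)⁻¹ = (-1) ^ k := inv_eq_of_mul_eq_one_left hs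
  rw [one_sub_paramT, paramT, binomRatio]
  split_ifs
  · rw [poch_one_add_natCast, poch_neg_natCast_eq_choose _ _ (by omega), mul_inv, hs']
    field_simp
  · rw [show -(n : ℝ) - P s = -((n + P s : ℕ) : ℝ) by push_cast; ring, poch_one_add_natCast,
      poch_neg_natCast_eq_choose _ _ (by omega)]
    field_simp

/-- Each parameter contributes a sign `(-1) ^ k`; their number is even, so the signs disappear. -/
lemma wellPoised_zero (M n v : ℕ) (P : ℕ → ℕ) (hM : Even M) (k : ℕ) (hk : k ≤ n) :
    wellPoised M n (paramT n v P) k 0 =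
      (n.choose k : ℝ) ^ 2 * ∏ s ∈ Finset.Icc 1 M, binomRatio n v P s k := by
  have hs : ((-1 : ℝ) ^ k) * (-1) ^ k = 1 := by rw [← mul_pow]; simp
  have hkf : (k.factorial : ℝ) ≠ 0 := by positivity
  simp only [wellPoised, sub_zero, poch_paramT_ratio n v P _ k hk]
  rw [Finset.prod_mul_distrib, Finset.prod_const, Nat.card_Icc, Nat.add_sub_cancel, ← pow_mul,
    mul_comm k M, pow_mul, hM.neg_one_pow, one_pow, poch_neg_natCast_eq_choose _ _ hk, poch_one]
  field_simp
  linear_combination (n.choose k : ℝ) ^ 2 * (∏ s ∈ Finset.Icc 1 M, binomRatio n v P s k) * hs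

lemma hasLogDerivAt_wellPoised (M n v : ℕ) (P : ℕ → ℕ) (k : ℕ) (hk : k ≤ n) :
    HasLogDerivAt (wellPoised M n (paramT n v P) k)
      ((harmonic n : ℝ) - harmonic (n - k) + harmonic k +
        ∑ s ∈ Finset.Icc 1 M, logDerivTerm n v P s k) 0 := by
  have hfk : (k.factorial : ℝ) ≠ 0 := by positivity
  have hn : ∀ j < k, -(n : ℝ) + (j : ℝ) ≠ 0 := fun j hj h => by
    have : (j : ℝ) < n := by exact_mod_cast (by omega : j < n)
    linarith
  have h1 : ∀ j < k, 1 + (j : ℝ) ≠ 0 := fun j _ => by positivity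
  have d1 := hasLogDerivAt_poch hn
  rw [sum_inv_neg_add_natCast n k hk] at d1
  have d2 := hasLogDerivAt_poch h1
  have e2 := sum_inv_add_natCast 0 k
  simp only [Nat.cast_zero, add_zero, harmonic_zero, Rat.cast_zero, sub_zero] at e2
  rw [e2] at d2
  have d3 : ∀ s ∈ Finset.Icc 1 M, HasLogDerivAt
      (fun x => poch (paramT n v P s) k * (poch (1 - n - paramT n v P s - x) k)⁻¹)
      (logDerivTerm n v P s k) 0 := by
    intro s _
    have hs : ∀ j < k, 1 - (n : ℝ) - paramT n v P s + j ≠ 0 := fun j hj =>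
      one_sub_paramT_add_ne_zero n v P s j (by omega)
    have := (hasLogDerivAt_const (poch (paramT n v P s) k) 0).mul
      ((hasLogDerivAt_poch hs).inv (by simpa using poch_ne_zero hs))
    convert this using 1
    rw [one_sub_paramT, logDerivTerm, zero_add, neg_neg]
    split_ifs
    · rw [sum_inv_neg_add_natCast _ _ (by omega), show n + P s - k = n - k + P s by omega]
    · rw [sum_inv_add_natCast]
  have := ((d1.mul (hasLogDerivAt_const (poch (-n) k) 0)).mul
    (((hasLogDerivAt_const (k.factorial : ℝ) 0).mul d2).inv
      (mul_ne_zero hfk (by simpa using poch_ne_zero h1)))).mul (HasLogDerivAt.prod _ d3)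
  exact HasDerivAt.congr_deriv this (by congr 1; ring)

/-! ### The reflection `k ↦ n - k`. -/

lemma sum_range_eq_zero_of_antisymm {n : ℕ} {u : ℕ → ℝ} (hu : ∀ k ≤ n, u (n - k) = -u k) :
    ∑ k ∈ Finset.range (n + 1), u k = 0 := by
  have h := Finset.sum_flip (n := n) u
  rw [Finset.sum_congr rfl fun k hk => hu k (Nat.lt_succ_iff.mp (Finset.mem_range.mp hk)),
    Finset.sum_neg_distrib] at h
  linarith

/-- Against an antisymmetric weight constants sum to zero, and reflecting the index turns `-A (n -
k)` into `A k`. -/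
lemma sum_antisymm_mul {n : ℕ} {u : ℕ → ℝ} (hu : ∀ k ≤ n, u (n - k) = -u k) (c : ℝ)
    (A B : ℕ → ℝ) :
    ∑ k ∈ Finset.range (n + 1), u k * (c + B k - A (n - k)) =
      ∑ k ∈ Finset.range (n + 1), u k * (A k + B k) := by
  have h := Finset.sum_flip (n := n) fun k => u k * A k
  have h' : ∑ k ∈ Finset.range (n + 1), u k * A (n - k) =
      -∑ k ∈ Finset.range (n + 1), u k * A k := by
    rw [← h, ← Finset.sum_neg_distrib]
    refine Finset.sum_congr rfl fun k hk => ?_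
    rw [hu k (Nat.lt_succ_iff.mp (Finset.mem_range.mp hk))]
    ring
  simp only [mul_add, mul_sub, Finset.sum_add_distrib, Finset.sum_sub_distrib, h',
    ← Finset.sum_mul, sum_range_eq_zero_of_antisymm hu]
  ring

lemma binomRatio_symm (n v : ℕ) (P : ℕ → ℕ) (s k : ℕ) (hk : k ≤ n) :
    binomRatio n v P s (n - k) = binomRatio n v P s k := by
  obtain ⟨d, rfl⟩ := Nat.exists_eq_add_of_le hk
  -- Both sides equal `(d + P s)! (k + P s)! / ((P s)! (k + d + P s)!)`, which is symmetric in `k`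
  -- and `d`.
  have key : (((d + P s).choose d : ℕ) : ℝ) / ((k + d + P s).choose d : ℕ) =
      ((k + P s).choose k : ℕ) / ((k + d + P s).choose k : ℕ) := by
    rw [Nat.cast_choose ℝ (by omega : d ≤ d + P s), Nat.cast_choose ℝ (by omega : k ≤ k + P s),
      Nat.cast_choose ℝ (by omega : k ≤ k + d + P s), Nat.cast_choose ℝ (by omega : d ≤ k + d + P s),
      show d + P s - d = P s by omega, show k + P s - k = P s by omega,
      show k + d + P s - k = d + P s by omega, show k + d + P s - d = k + P s by omega]
    field_simp
  have e : k + d - k = d := by omega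
  unfold binomRatio
  rw [e]
  split_ifs
  · exact key
  · rw [← inv_inj, inv_div, inv_div]; exact key

/-- The very-well-poised weight at `x = 0`. -/
noncomputable def poisedWeight (M n v : ℕ) (P : ℕ → ℕ) (k : ℕ) : ℝ :=
  (n.choose k : ℝ) ^ 2 * ∏ s ∈ Finset.Icc 1 M, binomRatio n v P s k

lemma poisedWeight_antisymm (M n v : ℕ) (P : ℕ → ℕ) (k : ℕ) (hk : k ≤ n) :
    ((n : ℝ) - 2 * (n - k : ℕ)) * poisedWeight M n v P (n - k) =
      -(((n : ℝ) - 2 * k) * poisedWeight M n v P k) := by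
  simp only [poisedWeight, binomRatio_symm n v P _ k hk, Nat.choose_symm hk, Nat.cast_sub hk]
  ring

lemma prod_Icc_ite {v M : ℕ} (hv : v ≤ M) (f g : ℕ → ℝ) :
    ∏ s ∈ Finset.Icc 1 M, (if s ≤ v then f s else g s) =
      (∏ s ∈ Finset.Icc 1 v, f s) * ∏ s ∈ Finset.Icc (v + 1) M, g s := by
  rw [Finset.prod_ite]
  congr 1 <;> refine Finset.prod_congr ?_ fun _ _ => rfl <;> ext s <;>
    simp only [Finset.mem_filter, Finset.mem_Icc] <;> omega

lemma sum_Icc_ite {v M : ℕ} (hv : v ≤ M) (f g : ℕ → ℝ) :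
    ∑ s ∈ Finset.Icc 1 M, (if s ≤ v then f s else g s) =
      (∑ s ∈ Finset.Icc 1 v, f s) + ∑ s ∈ Finset.Icc (v + 1) M, g s := by
  rw [Finset.sum_ite]
  congr 1 <;> refine Finset.sum_congr ?_ fun _ _ => rfl <;> ext s <;>
    simp only [Finset.mem_filter, Finset.mem_Icc] <;> omega

/-- The logarithmic derivative has the form `c + B k - A (n - k)`, so the reflection replaces it by
`A k + B k`, the harmonic bracket of `harmonicSum`. -/
lemma harmonicSum_eq (m n v : ℕ) (hv : v ≤ 2 * m + 2) (P : ℕ → ℕ) :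
    harmonicSum m n v P = ∑ k ∈ Finset.range (n + 1), poisedWeight (2 * (m + 1)) n v P k *
      (1 + (n - 2 * k) * ((harmonic n : ℝ) - harmonic (n - k) + harmonic k +
        ∑ s ∈ Finset.Icc 1 (2 * (m + 1)), logDerivTerm n v P s k)) := by
  set A : ℕ → ℝ := fun k => (harmonic k : ℝ) - ∑ s ∈ Finset.Icc 1 v, (harmonic (k + P s) : ℝ)
    with hA
  set B : ℕ → ℝ := fun k => (harmonic k : ℝ) +
    ∑ s ∈ Finset.Icc (v + 1) (2 * m + 2), (harmonic (k + P s) : ℝ) with hB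
  set c : ℝ := (harmonic n : ℝ) - ∑ s ∈ Finset.Icc 1 v, (harmonic (n + P s) : ℝ) -
    ∑ s ∈ Finset.Icc (v + 1) (2 * m + 2), (harmonic (P s) : ℝ) with hc
  have key := sum_antisymm_mul
    (u := fun k => ((n : ℝ) - 2 * k) * poisedWeight (2 * (m + 1)) n v P k)
    (fun k hk => poisedWeight_antisymm (2 * (m + 1)) n v P k hk) c A B
  have hl : ∀ k, (harmonic n : ℝ) - harmonic (n - k) + harmonic k +
      ∑ s ∈ Finset.Icc 1 (2 * (m + 1)), logDerivTerm n v P s k = c + B k - A (n - k) := by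
    intro k
    simp only [logDerivTerm]
    rw [sum_Icc_ite (by omega : v ≤ 2 * (m + 1)), Finset.sum_sub_distrib, Finset.sum_sub_distrib,
      hA, hB, hc, show 2 * (m + 1) = 2 * m + 2 by ring]
    ring
  have hr : harmonicSum m n v P = ∑ k ∈ Finset.range (n + 1), poisedWeight (2 * (m + 1)) n v P k *
      (1 + (n - 2 * k) * (A k + B k)) := by
    refine Finset.sum_congr rfl fun k _ => ?_
    simp only [poisedWeight, binomRatio]
    rw [prod_Icc_ite (by omega : v ≤ 2 * (m + 1)), hA, hB, show 2 * (m + 1) = 2 * m + 2 by ring]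
    ring
  have hsplit : ∀ w u e : ℝ, w * (1 + u * e) = w + u * w * e := fun w u e => by ring
  rw [hr]
  simp only [hl, hsplit]
  rw [Finset.sum_add_distrib, Finset.sum_add_distrib, key]

/-! ### The limit, and continuity outside the exceptional case. -/

/-- Near `0`, the nested sum is the difference quotient of `f`, because `f 0 = 0`. -/
lemma tendsto_nestedSum (m n v : ℕ) (hv : v ≤ 2 * m + 2) (P : ℕ → ℕ) :
    Tendsto (fun x : ℝ => nestedSum m n (paramT n v P) x) (𝓝[≠] 0) (𝓝 (harmonicSum m n v P)) := by
  set f : ℝ → ℝ := fun x => ∑ k ∈ Finset.range (n + 1),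
    (n - 2 * k + x) * wellPoised (2 * (m + 1)) n (paramT n v P) k x with hf
  have hw : ∀ k ∈ Finset.range (n + 1), wellPoised (2 * (m + 1)) n (paramT n v P) k 0 =
      poisedWeight (2 * (m + 1)) n v P k := fun k hk =>
    wellPoised_zero _ _ _ _ (even_two_mul _) _ (Nat.lt_succ_iff.mp (Finset.mem_range.mp hk))
  have hf0 : f 0 = 0 := by
    rw [hf]
    refine Eq.trans (Finset.sum_congr rfl fun k hk => ?_)
      (sum_range_eq_zero_of_antisymm
        (u := fun k => ((n : ℝ) - 2 * k) * poisedWeight (2 * (m + 1)) n v P k) fun k hk =>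
        poisedWeight_antisymm (2 * (m + 1)) n v P k hk)
    simp only [hw k hk, add_zero]
  have hd : HasDerivAt f (harmonicSum m n v P) 0 := by
    rw [harmonicSum_eq m n v hv P]
    refine HasDerivAt.fun_sum fun k hk => ?_
    have h1 := hasLogDerivAt_wellPoised (2 * (m + 1)) n v P k
      (Nat.lt_succ_iff.mp (Finset.mem_range.mp hk))
    unfold HasLogDerivAt at h1
    refine (((hasDerivAt_id (0 : ℝ)).const_add ((n : ℝ) - 2 * k)).fun_mul h1).congr_deriv ?_
    rw [hw k hk]
    simp only [id, add_zero]
    ring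
  have hT : ∀ s, ∃ z : ℤ, paramT n v P s = z := fun s => by
    unfold paramT
    split_ifs
    · exact ⟨1 + P s, by push_cast; ring⟩
    · exact ⟨-n - P s, by push_cast; ring⟩
  refine (hasDerivAt_iff_tendsto_slope.mp hd).congr' ?_
  -- A nonzero `x` with `|x| < 1` is not an integer.
  have hball : Metric.ball (0 : ℝ) 1 ∈ 𝓝[≠] (0 : ℝ) :=
    mem_nhdsWithin_of_mem_nhds (Metric.ball_mem_nhds 0 one_pos)
  filter_upwards [hball, self_mem_nhdsWithin] with x hx hx0
  rw [nestedSum_eq_wellPoised _ hT, slope_def_field, hf0, div_eq_inv_mul, sub_zero, sub_zero]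
  rintro z rfl
  rw [Metric.mem_ball, dist_zero_right, Real.norm_eq_abs, ← Int.cast_abs] at hx
  have : |z| < 1 := by exact_mod_cast hx
  exact hx0 (by simp [Int.abs_lt_one_iff.mp this])

lemma continuous_poch (k : ℕ) : Continuous fun x => poch x k :=
  (ascPochhammer ℝ k).continuous

/-- Two parameters of the same kind give a quantity of definite sign. A mixed pair forces `v = 2r +
3`, and a zero then means `P v - P (v + 1) = l - 1 - i`, which lies between `0` and `n - 1`: the
exceptional case. -/
lemma paramT_sum_ne_zero {n v : ℕ} {P : ℕ → ℕ}
    (h : ¬ (Odd v ∧ 3 ≤ v ∧ P (v + 1) ≤ P v ∧ P v < P (v + 1) + n))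
    (r l i : ℕ) (hl : l ≤ n) (hi : i < l) :
    paramT n v P (2 * r + 3) + paramT n v P (2 * r + 4) + n - l + i ≠ 0 := by
  intro h0
  unfold paramT at h0
  split_ifs at h0 with h1 h2 h2
  · have : (l : ℝ) ≤ n := by exact_mod_cast hl
    have : (0 : ℝ) ≤ P (2 * r + 3) := by positivity
    have : (0 : ℝ) ≤ P (2 * r + 4) := by positivity
    have : (0 : ℝ) ≤ i := by positivity
    linarith
  · obtain rfl : v = 2 * r + 3 := by omega
    refine h ⟨⟨r + 1, by ring⟩, by omega, ?_⟩
    have h0' : 1 + (P (2 * r + 3) : ℝ) + i = P (2 * r + 4) + l := by linarith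
    have : 1 + P (2 * r + 3) + i = P (2 * r + 4) + l := by exact_mod_cast h0'
    rw [show 2 * r + 3 + 1 = 2 * r + 4 by ring]
    omega
  · omega
  · have : (i : ℝ) < l := by exact_mod_cast hi
    have : (0 : ℝ) ≤ P (2 * r + 3) := by positivity
    have : (0 : ℝ) ≤ P (2 * r + 4) := by positivity
    have : (0 : ℝ) ≤ n := by positivity
    linarith

lemma continuousAt_nestedSum {m n v : ℕ} {P : ℕ → ℕ}
    (h : ¬ (Odd v ∧ 3 ≤ v ∧ P (v + 1) ≤ P v ∧ P v < P (v + 1) + n)) :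
    ContinuousAt (fun x : ℝ => nestedSum m n (paramT n v P) x) 0 := by
  have hT : ∀ s k, k ≤ n → poch (1 - 0 - n - paramT n v P s) k ≠ 0 := fun s k hk => by
    rw [sub_zero]
    exact poch_ne_zero fun j hj => one_sub_paramT_add_ne_zero n v P s j (by omega)
  have hc : ∀ {f : ℝ → ℝ} (k : ℕ), Continuous f → ContinuousAt (fun x => poch (f x) k) 0 :=
    fun k hf => ((continuous_poch k).comp hf).continuousAt
  unfold nestedSum
  refine ContinuousAt.mul (ContinuousAt.div ?_ ?_ ?_) (tendsto_finsetSum _ fun i hi =>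
    tendsto_finsetProd _ fun r _ => ?_)
  · exact (hc _ (by fun_prop)).mul (hc _ (by fun_prop))
  · exact (hc _ (by fun_prop)).mul (hc _ (by fun_prop))
  · exact mul_ne_zero (hT _ _ le_rfl) (hT _ _ le_rfl)
  · simp only [chains, Finset.mem_filter, Finset.mem_univ, true_and] at hi
    have hl : (i r.succ : ℕ) ≤ n := Nat.lt_succ_iff.mp (i r.succ).2
    have hjl : (i r.castSucc : ℕ) ≤ i r.succ := hi.1 _ _ (Fin.castSucc_lt_succ).le
    unfold nestedFactor
    refine ContinuousAt.div ?_ ?_ ?_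
    · exact (((hc _ (by fun_prop)).mul (hc _ (by fun_prop))).mul (hc _ (by fun_prop))).mul
        (hc _ (by fun_prop))
    · exact (((hc _ (by fun_prop)).mul (hc _ (by fun_prop))).mul (hc _ (by fun_prop))).mul
        (hc _ (by fun_prop))
    · refine mul_ne_zero (mul_ne_zero (mul_ne_zero ?_ ?_) (hT _ _ (by omega))) (hT _ _ (by omega))
      · rw [poch_one]; positivity
      · refine poch_ne_zero fun j hj => ?_
        rw [add_zero]
        exact paramT_sum_ne_zero h r _ j hl (by omega)

/-- The first part is the identity as displayed, whenever no denominator vanishes on the right;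
the second one gives it for all parameters, zero factors common to numerators and denominators
being removed by `x → 0`. -/
theorem theorem1 (m n v : ℕ) (hv : v ≤ 2 * m + 2) (P : ℕ → ℕ) :
    (¬ (Odd v ∧ 3 ≤ v ∧ P (v + 1) ≤ P v ∧ P v < P (v + 1) + n) →
      harmonicSum m n v P = nestedSum m n (paramT n v P) 0) ∧
    Tendsto (fun x : ℝ => nestedSum m n (paramT n v P) x) (𝓝[≠] 0) (𝓝 (harmonicSum m n v P)) :=
  ⟨fun h => tendsto_nhds_unique (tendsto_nestedSum m n v hv P)
    ((continuousAt_nestedSum h).tendsto.mono_left nhdsWithin_le_nhds),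
    tendsto_nestedSum m n v hv P⟩
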